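/- Let $n\ge 2$ and let $\Delta_n=\{p\in(0,1)^n : p_1+\cdots+p_n=1\}$ be the open unit simplex with its Borel $\sigma$-algebra. For $p,q\in\Delta_n$ put \[ c(p,q)=\log\Big(\frac1n\sum_{i=1}^n\frac{q_i}{p_i}\Big)-\frac1n\sum_{i=1}^n\log\frac{q_i}{p_i}\ \ (\ge 0),\qquad p^{-1}=\Big(\frac{1/p_i}{\sum_j 1/p_j}\Big)_{1\le i\le n}, \] and for $p\in\Delta_n$ and $q\in\overline{\Delta}_n$ put $p\odot q=\big(p_iq_i/\sum_j p_jq_j\big)_{1\le i\le n}$. A coupling of Borel probability measures $P,Q$ on $\Delta_n$ is a measure $R$ on $\Delta_n\times\Delta_n$ with marginals $P$ and $Q$; it is optimal if it attains the infimum $\mathbf C(P,Q)=\inf_R\int c\,dR$ over all couplings of $P$ and $Q$. A function $\varphi:\Delta_n\to\mathbb R$ is exponentially concave if $e^{\varphi}$ is concave; at a point $r$ where $\varphi$ is differentiable, the portfolio map generated by $\varphi$ is given by \[ (\boldsymbol\pi(r))_i=r_i\big(1+\nabla_{e_i-r}\varphi(r)\big),\qquad 1\le i\le n, \] where $e_1,\dots,e_n$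 is the standard basis of $\mathbb R^n$ and $\nabla_v$ is the directional derivative. **Theorem.** Let $P$ and $Q$ be Borel probability measures on $\Delta_n$ with finite log-moments, i.e. $\sum_{i}\int|\log p_i|\,dP(p)<\infty$ and $\sum_i\int|\log q_i|\,dQ(q)<\infty$, and let $P$ be absolutely continuous with respect to the $(n-1)$-dimensional Lebesgue measure on $\Delta_n$. Then there is an exponentially concave function $\varphi:\Delta_n\to\mathbb R$, with portfolio map $\boldsymbol\pi$, such that: (i) for $P$-a.e. $p$ the function $\varphi$ is differentiable at $p^{-1}$ and $T(p):=p\odot\boldsymbol\pi(p^{-1})$ belongs to $\Delta_n$, and the $P$-a.e. defined map $T$ pushes $P$ forward to $Q$; (ii) the deterministic coupling $(p,T(p))$, $p\sim P$, is optimal for the cost $c$, and it is unique: every optimal coupling of $P$ and $Q$ is the law of $(p,T(p))$ under $P$; in particular, every measurable map $S$ that pushes $P$ to $Q$ and for which $(p,S(p))$ is an optimal coupling satisfies $S=T$ $P$-a.e. -/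

import Mathlib

open MeasureTheory

noncomputable section

namespace SimplexTransport

/-- The open unit simplex `Δ_n ⊆ ℝⁿ`. -/
def openSimplex (n : ℕ) : Set (Fin n → ℝ) :=
  {p | (∀ i, p i ∈ Set.Ioo (0 : ℝ) 1) ∧ ∑ i, p i = 1}

/-- The open unit simplex as a type, with the relative topology and its Borel σ-algebra. -/
abbrev Simplex (n : ℕ) : Type := ↥(openSimplex n)

/-- The operation `p ⊙ q`: multiply coordinatewise and normalize. It is written for vectors of `ℝⁿ`
because the second factor may lie on the boundary of the simplex. -/
def odot {n : ℕ} (p q : Fin n → ℝ) : Fin n → ℝ :=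
  fun i => p i * q i / ∑ j, p j * q j

/-- The inverse `p⁻¹` of `p` for the operation `⊙`. -/
def simplexInv {n : ℕ} (p : Fin n → ℝ) : Fin n → ℝ :=
  fun i => (1 / p i) / ∑ j, 1 / p j

/-- The cost function `c(p, q)`. -/
def cost {n : ℕ} (p q : Simplex n) : ℝ :=
  Real.log ((1 / (n : ℝ)) * ∑ i, q.1 i / p.1 i) - (1 / (n : ℝ)) * ∑ i, Real.log (q.1 i / p.1 i)

/-- `R` is a coupling of `P` and `Q`. -/
def IsCoupling {n : ℕ} (P Q : Measure (Simplex n)) (R : Measure (Simplex n × Simplex n)) : Prop :=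
  R.map Prod.fst = P ∧ R.map Prod.snd = Q

/-- The expected cost `E_R[c(p, q)]`, a number in `[0, ∞]` as `c` is nonnegative. -/
def couplingCost {n : ℕ} (R : Measure (Simplex n × Simplex n)) : ENNReal :=
  ∫⁻ x : Simplex n × Simplex n, ENNReal.ofReal (cost x.1 x.2) ∂ R

/-- The optimal transport cost `C(P, Q)`. -/
def transportCost {n : ℕ} (P Q : Measure (Simplex n)) : ENNReal :=
  ⨅ (R : Measure (Simplex n × Simplex n)) (_ : IsCoupling P Q R), couplingCost R

/-- `R` is an optimal coupling of `P` and `Q`. -/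
def IsOptimalCoupling {n : ℕ} (P Q : Measure (Simplex n))
    (R : Measure (Simplex n × Simplex n)) : Prop :=
  IsCoupling P Q R ∧ couplingCost R = transportCost P Q

/-- The coordinates `(p_1, …, p_{n-1})` on `Δ_n`. -/
def simplexCoord (n : ℕ) (p : Simplex n) : Fin (n - 1) → ℝ :=
  fun i => p.1 (Fin.castLE (Nat.sub_le n 1) i)

/-- The `(n-1)`-dimensional Lebesgue measure on `Δ_n`, that is `dp_1 ⋯ dp_{n-1}` in the coordinates
`(p_1, …, p_{n-1})`. -/
def lebesgueSimplex (n : ℕ) : Measure (Simplex n) :=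
  Measure.comap (simplexCoord n) volume

lemma measurableSet_openSimplex (n : ℕ) : MeasurableSet (openSimplex n) := by
  have h : openSimplex n =
      (⋂ i, (fun p : Fin n → ℝ => p i) ⁻¹' Set.Ioo (0 : ℝ) 1) ∩
        (fun p : Fin n → ℝ => ∑ i, p i) ⁻¹' {1} := by
    ext p; simp [openSimplex]
  rw [h]
  refine MeasurableSet.inter (MeasurableSet.iInter fun i => ?_) ?_
  · exact measurable_pi_apply i measurableSet_Ioo
  · exact (by fun_prop : Measurable fun p : Fin n → ℝ => ∑ i, p i) (measurableSet_singleton 1)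

/-- The coordinate map is a measurable embedding, so that `lebesgueSimplex n` gives to a Borel set
the Lebesgue measure of its image in coordinates. -/
lemma measurableEmbedding_simplexCoord (n : ℕ) : MeasurableEmbedding (simplexCoord n) := by
  have : StandardBorelSpace (Simplex n) := (measurableSet_openSimplex n).standardBorel
  refine Measurable.measurableEmbedding ?_ ?_
  · exact measurable_pi_lambda _ fun i => (measurable_pi_apply _).comp measurable_subtype_coe
  · intro p q h
    apply Subtype.ext
    cases n with
    | zero => exact Subsingleton.elim _ _
    | succ m =>
      have hc : ∀ i : Fin m, p.1 i.castSucc = q.1 i.castSucc := fun i => congrFun h i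
      have hp := p.2.2
      have hq := q.2.2
      rw [Fin.sum_univ_castSucc] at hp hq
      rw [Finset.sum_congr rfl fun i _ => hc i] at hp
      funext i
      refine Fin.lastCases ?_ hc i
      linarith

/-- The class `𝓛`: finite log-moments. -/
def ClassL {n : ℕ} (P : Measure (Simplex n)) : Prop :=
  ∑ i : Fin n, ∫⁻ p, ENNReal.ofReal |Real.log (p.1 i)| ∂P < ⊤

/-- The class `𝓛_a`: finite log-moments and absolutely continuous. -/
def ClassLa {n : ℕ} (P : Measure (Simplex n)) : Prop :=
  ClassL P ∧ P.AbsolutelyContinuous (lebesgueSimplex n)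

/-- `φ` is exponentially concave on `Δ_n`. Only the values of `φ` on `Δ_n` matter, here and in
`DifferentiableAtSimplex` and `portfolioMap` at points of `Δ_n`. -/
def ExpConcave {n : ℕ} (φ : (Fin n → ℝ) → ℝ) : Prop :=
  ConcaveOn ℝ (openSimplex n) fun r => Real.exp (φ r)

/-- `φ`, as a function on `Δ_n`, is differentiable at `r`. -/
def DifferentiableAtSimplex {n : ℕ} (φ : (Fin n → ℝ) → ℝ) (r : Fin n → ℝ) : Prop :=
  DifferentiableWithinAt ℝ φ (openSimplex n) r

/-- The portfolio map `π(r)_i = r_i (1 + ∇_{e_i - r} φ(r))` generated by `φ`, meaningful where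
`φ` is differentiable. -/
def portfolioMap {n : ℕ} (φ : (Fin n → ℝ) → ℝ) (r : Fin n → ℝ) : Fin n → ℝ :=
  fun i => r i * (1 + lineDeriv ℝ φ r (Pi.single i 1 - r))

end SimplexTransport

end

namespace SimplexTransport
open MeasureTheory Filter Topology
open scoped ENNReal NNReal ProbabilityTheory

/-! Up to a function of `p` plus a function of `q`, the cost is log ⟨p⁻¹, q⟩ (`cost_eq`), and such
separable terms do not affect cyclical monotonicity. An optimal coupling exists by compactness. Its
cost is finite by the log-moments, so its support is cyclically monotone
(`sum_le_sum_of_mem_support_of_optimal`). Rockafellar's chain construction then gives φ as an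
infimum of functions r ↦ k + log ⟨r, q⟩. Their exponentials are linear in r, so e^φ is concave. In
the coordinates log (r_i / r_last) such an infimum is Lipschitz, so by Rademacher φ is
differentiable at p⁻¹ for almost every p. If (p, q) is in the support, φ - log ⟨·, q⟩ is maximal at
p⁻¹ over the simplex. The first-order condition there reads q = p ⊙ π(p⁻¹), so every optimal
coupling lies on a graph. Uniqueness follows by convexity: the midpoint of two optimal couplings is
optimal, hence carried by one graph, which then carries both. -/

/-! ### Optimal couplings on general spaces: existence and cyclical monotonicity -/

/-- The truncations min(f⁺, k) are bounded and continuous, so their integrals are weakly continuous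
in μ. The integral of f⁺ is the supremum of these over k. -/
lemma lowerSemicontinuous_lintegral_ofReal {X : Type*} [TopologicalSpace X] [MeasurableSpace X]
    [OpensMeasurableSpace X] {f : X → ℝ} (hf : Continuous f) :
    LowerSemicontinuous fun μ : ProbabilityMeasure X => ∫⁻ x, ENNReal.ofReal (f x) ∂(μ : Measure X) := by
  have key : (fun μ : ProbabilityMeasure X => ∫⁻ x, ENNReal.ofReal (f x) ∂(μ : Measure X)) =
      fun μ : ProbabilityMeasure X => ⨆ k : ℕ, ∫⁻ x, ((min (f x).toNNReal k : ℝ≥0) : ℝ≥0∞) ∂(μ : Measure X) := by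
    funext μ
    rw [← lintegral_iSup]
    · refine lintegral_congr fun x => ?_
      apply le_antisymm
      · obtain ⟨k, hk⟩ := exists_nat_ge (f x).toNNReal
        exact le_iSup_of_le k (by simp [hk, ENNReal.ofReal])
      · exact iSup_le fun k => by
          rw [ENNReal.ofReal]; exact_mod_cast min_le_left _ _
    · intro k
      exact (by fun_prop : Continuous fun x => ((min (f x).toNNReal k : ℝ≥0) : ℝ≥0∞)).measurable
    · intro a b hab x
      simp only [ENNReal.coe_le_coe]
      exact min_le_min_left _ (by exact_mod_cast hab)
  rw [key]
  refine lowerSemicontinuous_iSup fun k => Continuous.lowerSemicontinuous ?_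
  let g : BoundedContinuousFunction X ℝ≥0 :=
    BoundedContinuousFunction.mkOfBound ⟨fun x => min (f x).toNNReal k, by fun_prop⟩ k (by
      intro x y
      simp only [ContinuousMap.coe_mk, NNReal.dist_eq]
      have h1 : ((min (f x).toNNReal k : ℝ≥0) : ℝ) ≤ k := by exact_mod_cast min_le_right _ _
      have h2 : ((min (f y).toNNReal k : ℝ≥0) : ℝ) ≤ k := by exact_mod_cast min_le_right _ _
      rw [abs_le]
      constructor <;> linarith [(min (f x).toNNReal (k : ℝ≥0)).2, (min (f y).toNNReal (k : ℝ≥0)).2,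
        NNReal.coe_nonneg (min (f x).toNNReal (k : ℝ≥0)),
        NNReal.coe_nonneg (min (f y).toNNReal (k : ℝ≥0))])
  exact ProbabilityMeasure.continuous_lintegral_boundedContinuousFunction g

/-- Existence of an optimal coupling for a continuous cost on Polish spaces. -/
theorem exists_optimal_coupling {X Y : Type*} [TopologicalSpace X] [PolishSpace X]
    [MeasurableSpace X] [BorelSpace X] [TopologicalSpace Y] [PolishSpace Y]
    [MeasurableSpace Y] [BorelSpace Y] (μ : Measure X) (ν : Measure Y) [IsProbabilityMeasure μ]
    [IsProbabilityMeasure ν] {c : X × Y → ℝ} (hc : Continuous c) :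
    ∃ R : Measure (X × Y), (R.map Prod.fst = μ ∧ R.map Prod.snd = ν) ∧
      ∀ ρ : Measure (X × Y), ρ.map Prod.fst = μ → ρ.map Prod.snd = ν →
        ∫⁻ z, ENNReal.ofReal (c z) ∂ R ≤ ∫⁻ z, ENNReal.ofReal (c z) ∂ρ := by
  let S : Set (ProbabilityMeasure (X × Y)) :=
    {R | (R : Measure (X × Y)).map Prod.fst = μ ∧ (R : Measure (X × Y)).map Prod.snd = ν}
  have hne : S.Nonempty := 
    ⟨⟨μ.prod ν, inferInstance⟩, Measure.map_fst_prod.trans (by simp),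
      Measure.map_snd_prod.trans (by simp)⟩
  have hclosed : IsClosed S := by
    let μ' : ProbabilityMeasure X := ⟨μ, inferInstance⟩
    let ν' : ProbabilityMeasure Y := ⟨ν, inferInstance⟩
    have h1 : S = (fun R : ProbabilityMeasure (X × Y) =>
          R.map (f := Prod.fst) measurable_fst.aemeasurable) ⁻¹' {μ'} ∩
        (fun R : ProbabilityMeasure (X × Y) =>
          R.map (f := Prod.snd) measurable_snd.aemeasurable) ⁻¹' {ν'} := by
      ext R
      simp only [Set.mem_inter_iff, Set.mem_preimage, Set.mem_singleton_iff,
        ← ProbabilityMeasure.toMeasure_injective.eq_iff, ProbabilityMeasure.toMeasure_map]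
      rfl
    rw [h1]
    exact (isClosed_singleton.preimage (ProbabilityMeasure.continuous_map continuous_fst)).inter
      (isClosed_singleton.preimage (ProbabilityMeasure.continuous_map continuous_snd))
  -- The marginals are fixed, and a single measure on a Polish space is tight, so the couplings are
  -- tight and Prokhorov's theorem applies.
  have htight : IsTightMeasureSet {((R : ProbabilityMeasure (X × Y)) : Measure (X × Y)) | R ∈ S} := by
    apply IsTightMeasureSet.prodMk
    · refine (isTightMeasureSet_singleton (μ := μ)).subset ?_
      rintro _ ⟨_, ⟨R, hR, rfl⟩, rfl⟩
      exact hR.1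
    · refine (isTightMeasureSet_singleton (μ := ν)).subset ?_
      rintro _ ⟨_, ⟨R, hR, rfl⟩, rfl⟩
      exact hR.2
  have hcomp : IsCompact S := by
    have := isCompact_closure_of_isTightMeasureSet htight
    rwa [hclosed.closure_eq] at this
  obtain ⟨R, hR, hmin⟩ := LowerSemicontinuousOn.exists_isMinOn hne hcomp
    ((lowerSemicontinuous_lintegral_ofReal hc).lowerSemicontinuousOn S)
  refine ⟨R, hR, fun ρ h1 h2 => ?_⟩
  have hp : IsProbabilityMeasure ρ := by
    constructor
    rw [← Set.preimage_univ (f := Prod.fst), ← Measure.map_apply measurable_fst MeasurableSet.univ,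
      h1, measure_univ]
  exact hmin (show (⟨ρ, hp⟩ : ProbabilityMeasure (X × Y)) ∈ S from ⟨h1, h2⟩)

/-- The support of an optimal coupling for a continuous cost is cyclically monotone. -/
theorem sum_le_sum_of_mem_support_of_optimal {X Y : Type*} [TopologicalSpace X]
    [SecondCountableTopology X] [MeasurableSpace X] [BorelSpace X] [TopologicalSpace Y]
    [SecondCountableTopology Y] [MeasurableSpace Y] [BorelSpace Y] {R : Measure (X × Y)}
    [IsFiniteMeasure R] {c : X × Y → ℝ} (hc : Continuous c) (hc0 : ∀ z, 0 ≤ c z)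
    (hfin : ∫⁻ z, ENNReal.ofReal (c z) ∂ R ≠ ∞)
    (hopt : ∀ ρ : Measure (X × Y), ρ.map Prod.fst = R.map Prod.fst →
      ρ.map Prod.snd = R.map Prod.snd →
        ∫⁻ z, ENNReal.ofReal (c z) ∂ R ≤ ∫⁻ z, ENNReal.ofReal (c z) ∂ρ)
    {ι : Type*} [Fintype ι] {x : ι → X × Y} (hx : ∀ i, x i ∈ R.support) (σ : Equiv.Perm ι) :
    ∑ i, c (x i) ≤ ∑ i, c ((x i).1, (x (σ i)).2) := by
  by_contra! hlt
  have hne : Nonempty ι := by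
    by_contra h
    rw [not_nonempty_iff] at h
    simp at hlt
  have hm : (0 : ℝ) < Fintype.card ι := by exact_mod_cast Fintype.card_pos
  obtain ⟨ε, hε, hgap⟩ : ∃ ε > 0, ∑ i, (c ((x i).1, (x (σ i)).2) + ε) < ∑ i, (c (x i) - ε) := by
    -- With m points, the perturbation changes the gap by 2mε in total. This choice uses up half of
    -- it.
    refine ⟨(∑ i, c (x i) - ∑ i, c ((x i).1, (x (σ i)).2)) / (4 * Fintype.card ι),
      div_pos (by linarith) (by linarith), ?_⟩
    simp only [Finset.sum_add_distrib, Finset.sum_sub_distrib, Finset.sum_const,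
      Finset.card_univ, nsmul_eq_mul]
    field_simp
    linarith
  have hUV : ∀ i j, ∃ U : Set X, ∃ V : Set Y, IsOpen U ∧ IsOpen V ∧ (x i).1 ∈ U ∧ (x j).2 ∈ V ∧
      ∀ a ∈ U, ∀ b ∈ V, |c (a, b) - c ((x i).1, (x j).2)| < ε := by
    intro i j
    have h1 : {z : X × Y | |c z - c ((x i).1, (x j).2)| < ε} ∈ 𝓝 ((x i).1, (x j).2) := by
      refine IsOpen.mem_nhds ?_ (by simpa using hε)
      exact isOpen_lt (by fun_prop) continuous_const
    obtain ⟨U, V, hU, hxU, hV, hxV, hsub⟩ := mem_nhds_prod_iff'.1 h1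
    exact ⟨U, V, hU, hV, hxU, hxV, fun a ha b hb => hsub ⟨ha, hb⟩⟩
  choose U' V' hU'o hV'o hU' hV' hclose' using hUV
  let U : ι → Set X := fun i => ⋂ j, U' i j
  let V : ι → Set Y := fun j => ⋂ i, V' i j
  have hUo : ∀ i, IsOpen (U i) := fun i => isOpen_iInter_of_finite fun j => hU'o i j
  have hVo : ∀ j, IsOpen (V j) := fun j => isOpen_iInter_of_finite fun i => hV'o i j
  have hclose : ∀ i j, ∀ a ∈ U i, ∀ b ∈ V j, |c (a, b) - c ((x i).1, (x j).2)| < ε :=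
    fun i j a ha b hb => hclose' i j a (Set.mem_iInter.1 ha j) b (Set.mem_iInter.1 hb i)
  let A : ι → Set (X × Y) := fun i => U i ×ˢ V i
  have hAo : ∀ i, IsOpen (A i) := fun i => (hUo i).prod (hVo i)
  have hA : ∀ i, 0 < R (A i) := fun i =>
    (Measure.mem_support_iff_forall _).1 (hx i) _ ((hAo i).mem_nhds
      ⟨Set.mem_iInter.2 fun j => hU' i j, Set.mem_iInter.2 fun j => hV' j i⟩)
  let r : ι → Measure (X × Y) := fun i => (R (A i))⁻¹ • R.restrict (A i)
  have hr : ∀ i, IsProbabilityMeasure (r i) := fun i => ⟨by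
    simp only [r, Measure.smul_apply, Measure.restrict_apply_univ, smul_eq_mul]
    exact ENNReal.inv_mul_cancel (hA i).ne' (measure_ne_top _ _)⟩
  have hrA : ∀ i, ∀ᵐ z ∂(r i), z ∈ A i := fun i =>
    Measure.ae_smul_measure (ae_restrict_mem (hAo i).measurableSet) _
  -- The sets `A i` may overlap, so each `δ • r i` is allowed only the share 1/m of `R`; then their
  -- sum stays below `R`.
  obtain ⟨δ, hδ0, hδt, hδ⟩ : ∃ δ : ℝ≥0∞, δ ≠ 0 ∧ δ ≠ ∞ ∧
      ∀ i, δ * (R (A i))⁻¹ ≤ (Fintype.card ι : ℝ≥0∞)⁻¹ := by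
    obtain ⟨i₀, hi₀⟩ := Finite.exists_min fun i => R (A i)
    refine ⟨R (A i₀) * (Fintype.card ι : ℝ≥0∞)⁻¹, ?_, ?_, fun i => ?_⟩
    · exact mul_ne_zero (hA i₀).ne' (ENNReal.inv_ne_zero.2 (ENNReal.natCast_ne_top _))
    · exact ENNReal.mul_ne_top (measure_ne_top _ _)
        (ENNReal.inv_ne_top.2 (by exact_mod_cast Fintype.card_ne_zero))
    · rw [mul_right_comm]
      refine mul_le_of_le_one_left zero_le ?_
      calc R (A i₀) * (R (A i))⁻¹ ≤ R (A i) * (R (A i))⁻¹ := mul_le_mul_left (hi₀ i) _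
        _ ≤ 1 := ENNReal.mul_inv_le_one _
  have hle : ∑ i, δ • r i ≤ R := by
    have h1 : ∀ i, δ • r i ≤ (Fintype.card ι : ℝ≥0∞)⁻¹ • R := by
      intro i
      refine Measure.le_iff.2 fun s hs => ?_
      simp only [r, Measure.smul_apply, smul_eq_mul, ← mul_assoc]
      gcongr
      · exact hδ i
      · exact Measure.restrict_le_self
    calc ∑ i, δ • r i ≤ ∑ i : ι, (Fintype.card ι : ℝ≥0∞)⁻¹ • R :=
          Finset.sum_le_sum fun i _ => h1 i
      _ = R := by
          rw [Finset.sum_const, Finset.card_univ, ← Nat.cast_smul_eq_nsmul ℝ≥0∞, smul_smul,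
            ENNReal.mul_inv_cancel (by exact_mod_cast Fintype.card_ne_zero)
              (ENNReal.natCast_ne_top _), one_smul]
  have hfinS : IsFiniteMeasure (∑ i, δ • r i) := isFiniteMeasure_of_le R hle
  let ν := R - ∑ i, δ • r i
  have hνR : ν + ∑ i, δ • r i = R := Measure.sub_add_cancel_of_le hle
  let p : ι → Measure X := fun i => (r i).map Prod.fst
  let q : ι → Measure Y := fun i => (r i).map Prod.snd
  have hp : ∀ i, IsProbabilityMeasure (p i) := fun i =>
    Measure.isProbabilityMeasure_map measurable_fst.aemeasurable
  have hq : ∀ i, IsProbabilityMeasure (q i) := fun i =>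
    Measure.isProbabilityMeasure_map measurable_snd.aemeasurable
  -- The competitor: a little mass near each `x i` is recoupled as a product with permuted second
  -- marginals, which leaves both total marginals unchanged.
  let ρ := ν + ∑ i, δ • (p i).prod (q (σ i))
  have hfst : ρ.map Prod.fst = R.map Prod.fst := by
    conv_rhs => rw [← hνR]
    simp only [ρ]
    rw [Measure.map_add _ _ measurable_fst, Measure.map_add _ _ measurable_fst]
    congr 1
    ext s hs
    simp only [Measure.map_apply measurable_fst hs, Measure.finsetSum_apply, Measure.smul_apply]
    refine Finset.sum_congr rfl fun i _ => ?_
    rw [← Measure.map_apply measurable_fst hs, ← Measure.map_apply measurable_fst hs,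
      Measure.map_fst_prod]
    simp [p]
  have hsnd : ρ.map Prod.snd = R.map Prod.snd := by
    conv_rhs => rw [← hνR]
    simp only [ρ]
    rw [Measure.map_add _ _ measurable_snd, Measure.map_add _ _ measurable_snd]
    congr 1
    ext s hs
    simp only [Measure.map_apply measurable_snd hs, Measure.finsetSum_apply, Measure.smul_apply]
    rw [← Equiv.sum_comp σ fun i => δ • (r i) (Prod.snd ⁻¹' s)]
    refine Finset.sum_congr rfl fun i _ => ?_
    rw [← Measure.map_apply measurable_snd hs, ← Measure.map_apply measurable_snd hs,
      Measure.map_snd_prod]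
    simp [q]
  have hcost := hopt ρ hfst hsnd
  -- Finiteness allows the cost of the untouched part `ν` to be cancelled in [0, ∞].
  have hνfin : ∫⁻ z, ENNReal.ofReal (c z) ∂ν ≠ ∞ := by
    refine ne_top_of_le_ne_top hfin (lintegral_mono' ?_ le_rfl)
    exact Measure.sub_le
  nth_rewrite 1 [← hνR] at hcost
  simp only [ρ, lintegral_add_measure, lintegral_finsetSum_measure, lintegral_smul_measure,
    smul_eq_mul, ← Finset.mul_sum] at hcost
  rw [ENNReal.add_le_add_iff_left hνfin, ENNReal.mul_le_mul_iff_right hδ0 hδt] at hcost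
  have hlow : ENNReal.ofReal (∑ i, (c (x i) - ε)) ≤ ∑ i, ∫⁻ z, ENNReal.ofReal (c z) ∂(r i) := by
    refine (Finset.le_sum_of_subadditive ENNReal.ofReal ENNReal.ofReal_zero.le
      (fun _ _ => ENNReal.ofReal_add_le) _ _).trans (Finset.sum_le_sum fun i _ => ?_)
    calc ENNReal.ofReal (c (x i) - ε) = ∫⁻ _, ENNReal.ofReal (c (x i) - ε) ∂(r i) := by simp
      _ ≤ _ := by
        refine lintegral_mono_ae ?_
        filter_upwards [hrA i] with z hz
        refine ENNReal.ofReal_le_ofReal ?_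
        have := (abs_lt.1 (hclose i i z.1 hz.1 z.2 hz.2)).1
        simp only [Prod.mk.eta] at this
        linarith
  have hup : ∑ i, ∫⁻ z, ENNReal.ofReal (c z) ∂((p i).prod (q (σ i))) ≤
      ENNReal.ofReal (∑ i, (c ((x i).1, (x (σ i)).2) + ε)) := by
    rw [ENNReal.ofReal_sum_of_nonneg fun i _ => add_nonneg (hc0 _) hε.le]
    refine Finset.sum_le_sum fun i _ => ?_
    calc _ ≤ ∫⁻ _, ENNReal.ofReal (c ((x i).1, (x (σ i)).2) + ε) ∂((p i).prod (q (σ i))) := by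
          refine lintegral_mono_ae ?_
          have h1 : ∀ᵐ a ∂(p i), a ∈ U i := by
            refine (ae_map_iff measurable_fst.aemeasurable (hUo i).measurableSet).2 ?_
            filter_upwards [hrA i] with z hz using hz.1
          have h2 : ∀ᵐ b ∂(q (σ i)), b ∈ V (σ i) := by
            refine (ae_map_iff measurable_snd.aemeasurable (hVo _).measurableSet).2 ?_
            filter_upwards [hrA (σ i)] with z hz using hz.2
          filter_upwards [Measure.quasiMeasurePreserving_fst.ae h1,
            Measure.quasiMeasurePreserving_snd.ae h2] with z hz1 hz2
          refine ENNReal.ofReal_le_ofReal ?_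
          have := (abs_lt.1 (hclose i (σ i) z.1 hz1 z.2 hz2)).2
          linarith
      _ = _ := by simp
  have hfinal := (hlow.trans hcost).trans hup
  rw [ENNReal.ofReal_le_ofReal_iff
    (Finset.sum_nonneg fun i _ => add_nonneg (hc0 _) hε.le)] at hfinal
  linarith

/-! ### The simplex as a Polish space -/

variable {n : ℕ}

lemma Simplex.pos (p : Simplex n) (i : Fin n) : 0 < p.1 i := (p.2.1 i).1

lemma Simplex.le_one (p : Simplex n) (i : Fin n) : p.1 i ≤ 1 := (p.2.1 i).2.le

lemma Simplex.neZero (p : Simplex n) : NeZero n := ⟨by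
  rintro rfl
  simpa using p.2.2⟩

/-- The simplex is not closed in ℝⁿ, but it is closed in the open cube, which is Polish as an open
subset of ℝⁿ. -/
instance polishSpace_simplex (n : ℕ) : PolishSpace (Simplex n) := by
  have h1 : IsOpen {p : Fin n → ℝ | ∀ i, p i ∈ Set.Ioo (0 : ℝ) 1} := by
    have : {p : Fin n → ℝ | ∀ i, p i ∈ Set.Ioo (0 : ℝ) 1} =
        Set.univ.pi fun _ => Set.Ioo (0 : ℝ) 1 := by ext; simp
    rw [this]
    exact isOpen_set_pi Set.finite_univ fun _ _ => isOpen_Ioo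
  have h2 : IsClosed {p : Fin n → ℝ | ∑ i, p i = 1} :=
    isClosed_eq (by fun_prop) continuous_const
  have := h1.polishSpace
  have hsub : openSimplex n ⊆ {p : Fin n → ℝ | ∀ i, p i ∈ Set.Ioo (0 : ℝ) 1} := fun p hp => hp.1
  refine IsClosedEmbedding.polishSpace (f := Set.inclusion hsub) ⟨IsEmbedding.inclusion hsub, ?_⟩
  have hrange : Set.range (Set.inclusion hsub) = Subtype.val ⁻¹' {p | ∑ i, p i = 1} := by
    rw [Set.range_inclusion]
    ext p
    exact ⟨fun hp => hp.2, fun hp => ⟨p.2, hp⟩⟩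
  rw [hrange]
  exact h2.preimage continuous_subtype_val

/-! ### Infima of the functions k + log ⟨r, q⟩ -/

/-- The pairing of a positive vector with a point of the simplex is positive. -/
lemma sum_mul_pos {r : Fin n → ℝ} (hr : ∀ i, 0 < r i) (q : Simplex n) :
    0 < ∑ i, r i * q.1 i := by
  have := q.neZero
  exact Finset.sum_pos (fun i _ => mul_pos (hr i) (q.pos i)) Finset.univ_nonempty

lemma log_sum_mul_le {r s : Fin n → ℝ} (hr : ∀ i, 0 < r i) (hs : ∀ i, 0 < s i) {d : ℝ}
    (h : ∀ i, r i ≤ Real.exp d * s i) (q : Simplex n) :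
    Real.log (∑ i, r i * q.1 i) ≤ Real.log (∑ i, s i * q.1 i) + d := by
  have h1 : ∑ i, r i * q.1 i ≤ Real.exp d * ∑ i, s i * q.1 i := by
    rw [Finset.mul_sum]
    refine Finset.sum_le_sum fun i _ => ?_
    rw [← mul_assoc]
    exact mul_le_mul_of_nonneg_right (h i) (q.pos i).le
  have h2 := Real.log_le_log (sum_mul_pos hr q) h1
  rw [Real.log_mul (Real.exp_pos d).ne' (sum_mul_pos hs q).ne', Real.log_exp] at h2
  linarith

/-- The infimum of the functions `r ↦ k + log ⟨r, q⟩` over the pairs `(k, q)` in `S`. -/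
noncomputable def logPotential (S : Set (ℝ × Simplex n)) (r : Fin n → ℝ) : ℝ :=
  ⨅ s : S, (s.1.1 + Real.log (∑ i, r i * s.1.2.1 i))

/-- The values at some positive vector of the functions indexed by `S` are bounded below. -/
def IsLowerBounded (S : Set (ℝ × Simplex n)) : Prop :=
  ∃ r : Fin n → ℝ, (∀ i, 0 < r i) ∧ ∃ b : ℝ, ∀ s ∈ S, b ≤ s.1 + Real.log (∑ i, r i * s.2.1 i)

/-- Moving from `r₀` to `r` lowers log ⟨·, q⟩ by at most the maximum of log (r₀ᵢ / rᵢ), uniformly in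
q. A lower bound at one positive vector thus gives one at every other. -/
lemma IsLowerBounded.bddBelow {S : Set (ℝ × Simplex n)} (hS : IsLowerBounded S)
    {r : Fin n → ℝ} (hr : ∀ i, 0 < r i) :
    BddBelow (Set.range fun s : S => s.1.1 + Real.log (∑ i, r i * s.1.2.1 i)) := by
  obtain ⟨r₀, hr₀, b, hb⟩ := hS
  obtain ⟨d, hd⟩ : ∃ d, ∀ i, Real.log (r₀ i / r i) ≤ d := by
    obtain ⟨d, hd⟩ := (Set.finite_range fun i => Real.log (r₀ i / r i)).bddAbove
    exact ⟨d, fun i => hd ⟨i, rfl⟩⟩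
  refine ⟨b - d, ?_⟩
  rintro _ ⟨s, rfl⟩
  have h := log_sum_mul_le hr₀ hr (d := d) (fun i => by
    rw [← div_le_iff₀ (hr i), ← Real.log_le_iff_le_exp (div_pos (hr₀ i) (hr i))]
    exact hd i) s.1.2
  have := hb s.1 s.2
  simp only
  linarith

lemma logPotential_le {S : Set (ℝ × Simplex n)} (hS : IsLowerBounded S)
    {r : Fin n → ℝ} (hr : ∀ i, 0 < r i) {s : ℝ × Simplex n} (hs : s ∈ S) :
    logPotential S r ≤ s.1 + Real.log (∑ i, r i * s.2.1 i) :=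
  ciInf_le (hS.bddBelow hr) ⟨s, hs⟩

lemma le_logPotential {S : Set (ℝ × Simplex n)} (hne : S.Nonempty) {r : Fin n → ℝ} {b : ℝ}
    (h : ∀ s ∈ S, b ≤ s.1 + Real.log (∑ i, r i * s.2.1 i)) : b ≤ logPotential S r := by
  have := hne.to_subtype
  exact le_ciInf fun s => h s.1 s.2

lemma convex_openSimplex (n : ℕ) : Convex ℝ (openSimplex n) := by
  intro p hp q hq a b ha hb hab
  refine ⟨fun i => convex_Ioo 0 1 (hp.1 i) (hq.1 i) ha hb hab, ?_⟩
  simp [Finset.sum_add_distrib, ← Finset.mul_sum, hp.2, hq.2, hab]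

/-- The exponential of each k + log ⟨r, q⟩ is linear in r, and an infimum of linear functions is
concave. -/
lemma expConcave_logPotential {S : Set (ℝ × Simplex n)} (hne : S.Nonempty)
    (hS : IsLowerBounded S) : ExpConcave (logPotential S) := by
  refine ⟨convex_openSimplex n, fun p hp q hq a b ha hb hab => ?_⟩
  have hpq := convex_openSimplex n hp hq ha hb hab
  have hpos : 0 < a • Real.exp (logPotential S p) + b • Real.exp (logPotential S q) := by
    simp only [smul_eq_mul]
    rcases ha.lt_or_eq with h | h
    · have := mul_pos h (Real.exp_pos (logPotential S p)); positivity
    · have hb1 : b = 1 := by linarith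
      rw [← h, hb1]; simpa using Real.exp_pos _
  rw [← Real.log_le_iff_le_exp hpos]
  refine le_logPotential hne fun s hs => ?_
  have hbound : ∀ r ∈ openSimplex n, Real.exp (logPotential S r) ≤
      Real.exp s.1 * ∑ i, r i * s.2.1 i := by
    intro r hr
    have hr0 : ∀ i, 0 < r i := fun i => (hr.1 i).1
    calc Real.exp (logPotential S r) ≤ Real.exp (s.1 + Real.log (∑ i, r i * s.2.1 i)) :=
          Real.exp_le_exp.2 (logPotential_le hS hr0 hs)
      _ = _ := by rw [Real.exp_add, Real.exp_log (sum_mul_pos hr0 s.2)]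
  have hpq0 := sum_mul_pos (fun i => (hpq.1 i).1) s.2
  rw [← Real.log_exp s.1, ← Real.log_mul (Real.exp_pos _).ne' hpq0.ne']
  refine Real.log_le_log hpos ?_
  have hlin : ∑ i, (a • p + b • q) i * s.2.1 i =
      a * ∑ i, p i * s.2.1 i + b * ∑ i, q i * s.2.1 i := by
    simp only [Pi.add_apply, Pi.smul_apply, smul_eq_mul, Finset.mul_sum, ← Finset.sum_add_distrib]
    exact Finset.sum_congr rfl fun i _ => by ring
  rw [hlin]
  have h1 := mul_le_mul_of_nonneg_left (hbound p hp) ha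
  have h2 := mul_le_mul_of_nonneg_left (hbound q hq) hb
  simp only [smul_eq_mul]
  linarith

lemma logPotential_le_add {S : Set (ℝ × Simplex n)} (hne : S.Nonempty) (hS : IsLowerBounded S)
    {r s : Fin n → ℝ} (hr : ∀ i, 0 < r i) (hs : ∀ i, 0 < s i) {d : ℝ}
    (h : ∀ i, r i ≤ Real.exp d * s i) : logPotential S r ≤ logPotential S s + d := by
  rw [← sub_le_iff_le_add]
  refine le_logPotential hne fun t ht => ?_
  have h1 := logPotential_le hS hr ht
  have h2 := log_sum_mul_le hr hs h t.2
  linarith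

lemma logPotential_smul {S : Set (ℝ × Simplex n)} (hne : S.Nonempty) (hS : IsLowerBounded S)
    {r : Fin n → ℝ} (hr : ∀ i, 0 < r i) {t : ℝ} (ht : 0 < t) :
    logPotential S (fun i => t * r i) = logPotential S r + Real.log t := by
  apply le_antisymm
  · exact logPotential_le_add hne hS (fun i => mul_pos ht (hr i)) hr fun i => by
      rw [Real.exp_log ht]
  · have := logPotential_le_add hne hS hr (s := fun i => t * r i) (fun i => mul_pos ht (hr i))
      (d := - Real.log t) fun i => by
        rw [Real.exp_neg, Real.exp_log ht, inv_mul_cancel_left₀ ht.ne']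
    linarith

/-! ### Almost everywhere differentiability -/

/-- The potential in the coordinates `log (r_i / r_last)`. -/
noncomputable def logRatioPotential {m : ℕ} (S : Set (ℝ × Simplex (m + 1))) (z : Fin m → ℝ) : ℝ :=
  logPotential S fun i => Real.exp ((Fin.snoc z 0 : Fin (m + 1) → ℝ) i)

/-- If the logarithms of the coordinates move by at most d, then ⟨r, q⟩ changes by a factor of at
most e^d. This bound passes to the infimum, with constant 1 for the sup norm. -/
lemma lipschitzWith_logRatioPotential {m : ℕ} {S : Set (ℝ × Simplex (m + 1))} (hne : S.Nonempty)
    (hS : IsLowerBounded S) : LipschitzWith 1 (logRatioPotential S) := by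
  refine LipschitzWith.of_le_add fun z w => ?_
  refine logPotential_le_add hne hS (fun i => Real.exp_pos _) (fun i => Real.exp_pos _) fun i => ?_
  rw [← Real.exp_add, Real.exp_le_exp]
  refine Fin.lastCases ?_ (fun j => ?_) i
  · simp
  · simp only [Fin.snoc_castSucc]
    have := (le_abs_self (z j - w j)).trans (Real.dist_eq (z j) (w j) ▸ dist_le_pi_dist z w j)
    linarith

/-- Logarithmic homogeneity reduces the potential on the open positive cone to its values in the m
log-ratio coordinates. The cone is open in ℝᵐ⁺¹, so ambient differentiability makes sense. -/
lemma logPotential_eq {m : ℕ} {S : Set (ℝ × Simplex (m + 1))} (hne : S.Nonempty)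
    (hS : IsLowerBounded S) {r : Fin (m + 1) → ℝ} (hr : ∀ i, 0 < r i) :
    logPotential S r =
      logRatioPotential S (fun i => Real.log (r i.castSucc) - Real.log (r (Fin.last m))) +
        Real.log (r (Fin.last m)) := by
  rw [logRatioPotential, ← logPotential_smul hne hS (fun i => Real.exp_pos _) (hr _)]
  congr 1
  funext i
  refine Fin.lastCases ?_ (fun j => ?_) i
  · simp
  · simp only [Fin.snoc_castSucc]
    rw [Real.exp_sub, Real.exp_log (hr _), Real.exp_log (hr _), mul_div_cancel₀ _ (hr _).ne']

lemma differentiableAt_logPotential {m : ℕ} {S : Set (ℝ × Simplex (m + 1))} (hne : S.Nonempty)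
    (hS : IsLowerBounded S) {r : Fin (m + 1) → ℝ} (hr : ∀ i, 0 < r i)
    (h : DifferentiableAt ℝ (logRatioPotential S)
      fun i => Real.log (r i.castSucc) - Real.log (r (Fin.last m))) :
    DifferentiableAt ℝ (logPotential S) r := by
  have hopen : ∀ᶠ s in 𝓝 r, ∀ i, 0 < s i :=
    eventually_all.2 fun i => (continuous_apply i).continuousAt.eventually_const_lt (hr i)
  have heq : logPotential S =ᶠ[𝓝 r] fun s =>
      logRatioPotential S (fun i => Real.log (s i.castSucc) - Real.log (s (Fin.last m))) +
        Real.log (s (Fin.last m)) := hopen.mono fun s hs => logPotential_eq hne hS hs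
  refine DifferentiableAt.congr_of_eventuallyEq ?_ heq
  have hlog : ∀ i, DifferentiableAt ℝ (fun s : Fin (m + 1) → ℝ => Real.log (s i)) r := fun i =>
    (differentiableAt_apply i r).log (hr i).ne'
  refine DifferentiableAt.add ?_ (hlog _)
  exact DifferentiableAt.comp r (f := fun s : Fin (m + 1) → ℝ => fun i : Fin m =>
    Real.log (s i.castSucc) - Real.log (s (Fin.last m))) h
    (differentiableAt_pi.2 fun i => (hlog _).sub (hlog _))

lemma sum_inv_pos (p : Simplex n) : 0 < ∑ j, 1 / p.1 j := by
  have := p.neZero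
  exact Finset.sum_pos (fun j _ => one_div_pos.2 (p.pos j)) Finset.univ_nonempty

lemma simplexInv_pos (p : Simplex n) (i : Fin n) : 0 < simplexInv p.1 i :=
  div_pos (one_div_pos.2 (p.pos i)) (sum_inv_pos p)

lemma simplexInv_mem (hn : 2 ≤ n) (p : Simplex n) : simplexInv p.1 ∈ openSimplex n := by
  have hsum : ∑ i, simplexInv p.1 i = 1 := by
    simp only [simplexInv, ← Finset.sum_div]
    exact div_self (sum_inv_pos p).ne'
  refine ⟨fun i => ⟨simplexInv_pos p i, ?_⟩, hsum⟩
  obtain ⟨j, hj⟩ : ∃ j, j ≠ i := by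
    have : Nontrivial (Fin n) := Fin.nontrivial_iff_two_le.2 hn
    exact exists_ne i
  rw [← hsum]
  exact Finset.single_lt_sum hj (Finset.mem_univ i) (Finset.mem_univ j) (simplexInv_pos p j)
    fun k _ _ => (simplexInv_pos p k).le

/-- The potential is differentiable at `p⁻¹` for Lebesgue almost every `p`. -/
lemma ae_differentiableAt_logPotential {S : Set (ℝ × Simplex n)} (hne : S.Nonempty)
    (hS : IsLowerBounded S) :
    ∀ᵐ p ∂(lebesgueSimplex n), DifferentiableAt ℝ (logPotential S) (simplexInv p.1) := by
  obtain ⟨s₀, hs₀⟩ := id hne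
  obtain ⟨m, rfl⟩ := Nat.exists_eq_succ_of_ne_zero s₀.2.neZero.ne
  set N : Set (Fin m → ℝ) := {z | ¬ DifferentiableAt ℝ (logRatioPotential S) z}
  have hN : volume N = 0 := (lipschitzWith_logRatioPotential hne hS).ae_differentiableAt
  -- `H` sends the log-ratio coordinates of p⁻¹, namely log p_last - log p_i, to the coordinates p_i
  -- of p. Being differentiable, it maps null sets to null sets.
  let H : (Fin m → ℝ) → (Fin m → ℝ) := fun z i => Real.exp (-z i) / (1 + ∑ j, Real.exp (-z j))
  have hH : Differentiable ℝ H := by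
    have h1 : ∀ z : Fin m → ℝ, 1 + ∑ j, Real.exp (-z j) ≠ 0 := fun z => by positivity
    exact differentiable_pi.2 fun i => by fun_prop (disch := exact h1 _)
  have hHN := addHaar_image_eq_zero_of_differentiableOn_of_addHaar_eq_zero volume
    (hH.differentiableOn (s := N)) hN
  rw [ae_iff, lebesgueSimplex, (measurableEmbedding_simplexCoord (m + 1)).comap_apply]
  refine measure_mono_null ?_ hHN
  rintro _ ⟨p, hp, rfl⟩
  refine ⟨fun i => Real.log (p.1 (Fin.last m)) - Real.log (p.1 i.castSucc), fun h => hp ?_, ?_⟩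
  · refine differentiableAt_logPotential hne hS (simplexInv_pos p) ?_
    convert h using 2 with i
    have hs := (sum_inv_pos p).ne'
    have hi := fun i => (one_div_pos.2 (p.pos i)).ne'
    simp only [simplexInv]
    rw [Real.log_div (hi _) hs, Real.log_div (hi _) hs, one_div, one_div, Real.log_inv,
      Real.log_inv]
    ring
  · have hl := p.pos (Fin.last m)
    have he : ∀ i : Fin m, Real.exp (-(Real.log (p.1 (Fin.last m)) - Real.log (p.1 i.castSucc))) =
        p.1 i.castSucc / p.1 (Fin.last m) := fun i => by
      rw [neg_sub, Real.exp_sub, Real.exp_log (p.pos _), Real.exp_log hl]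
    have hsum : 1 + ∑ j : Fin m, p.1 j.castSucc / p.1 (Fin.last m) = 1 / p.1 (Fin.last m) := by
      have h1 := p.2.2
      rw [Fin.sum_univ_castSucc] at h1
      rw [← Finset.sum_div, eq_div_iff hl.ne', add_mul, div_mul_cancel₀ _ hl.ne']
      linarith
    funext i
    simp only [H, he, hsum, simplexCoord]
    rw [div_div_div_cancel_right₀ hl.ne', div_one]
    rfl

/-! ### The first-order condition -/

/-- Where a potential is differentiable, its superdifferential is given by the portfolio map. -/
lemma portfolioMap_eq {φ : (Fin n → ℝ) → ℝ} {r : Fin n → ℝ} (hr : r ∈ openSimplex n)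
    (hφ : DifferentiableAt ℝ φ r) (q : Simplex n)
    (h : ∀ s ∈ openSimplex n, φ s ≤
      φ r + Real.log (∑ i, s i * q.1 i) - Real.log (∑ i, r i * q.1 i)) (i : Fin n) :
    portfolioMap φ r i = r i * q.1 i / ∑ j, r j * q.1 j := by
  set v : Fin n → ℝ := Pi.single i 1 - r with hv
  have hD : 0 < ∑ j, r j * q.1 j := sum_mul_pos (fun j => (hr.1 j).1) q
  have hvsum : ∑ j, v j = 0 := by
    simp [hv, Finset.sum_sub_distrib, hr.2]
  have hvq : ∑ j, v j * q.1 j = q.1 i - ∑ j, r j * q.1 j := by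
    simp [hv, sub_mul, Finset.sum_sub_distrib, Pi.single_apply]
  -- The direction e_i - r has coordinate sum zero, so the line stays in the open simplex for small
  -- t of both signs.
  have hmem : ∀ᶠ t : ℝ in 𝓝 0, r + t • v ∈ openSimplex n := by
    have h1 : ∀ᶠ t : ℝ in 𝓝 0, ∀ j, (r + t • v) j ∈ Set.Ioo (0 : ℝ) 1 := by
      refine eventually_all.2 fun j => ?_
      have hc : ContinuousAt (fun t : ℝ => (r + t • v) j) 0 := by
        simp only [Pi.add_apply, Pi.smul_apply, smul_eq_mul]; fun_prop
      exact hc.eventually_mem (Ioo_mem_nhds (by simpa using (hr.1 j).1) (by simpa using (hr.1 j).2))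
    filter_upwards [h1] with t ht
    exact ⟨ht, by simp [Finset.sum_add_distrib, ← Finset.mul_sum, hvsum, hr.2]⟩
  have hder : HasDerivAt (fun t : ℝ => φ (r + t • v)) (lineDeriv ℝ φ r v) 0 :=
    hφ.lineDifferentiableAt.hasLineDerivAt
  have hlin : HasDerivAt (fun t : ℝ => ∑ j, (r + t • v) j * q.1 j) (∑ j, v j * q.1 j) 0 := by
    refine HasDerivAt.fun_sum fun j _ => ?_
    have := (((hasDerivAt_id (0 : ℝ)).mul_const (v j)).const_add (r j)).mul_const (q.1 j)
    simpa using this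
  have hlog := hlin.log (by simpa using hD.ne')
  have hmax : IsLocalMax (fun t : ℝ => φ (r + t • v) - Real.log (∑ j, (r + t • v) j * q.1 j)) 0 := by
    filter_upwards [hmem] with t ht
    have := h _ ht
    simp only [zero_smul, add_zero]
    linarith
  have h0 := hmax.hasDerivAt_eq_zero (hder.sub hlog)
  simp only [zero_smul, add_zero] at h0
  have h1 : lineDeriv ℝ φ r v = (q.1 i - ∑ j, r j * q.1 j) / ∑ j, r j * q.1 j := by
    rw [← hvq]; linarith
  simp only [portfolioMap]
  rw [← hv, h1]
  field_simp
  ring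

lemma odot_portfolioMap_eq (hn : 2 ≤ n) {φ : (Fin n → ℝ) → ℝ} (p q : Simplex n)
    (hφ : DifferentiableAt ℝ φ (simplexInv p.1))
    (h : ∀ s ∈ openSimplex n, φ s ≤ φ (simplexInv p.1) + Real.log (∑ i, s i * q.1 i) -
      Real.log (∑ i, simplexInv p.1 i * q.1 i)) :
    odot p.1 (portfolioMap φ (simplexInv p.1)) = q.1 := by
  have hD : 0 < ∑ j, simplexInv p.1 j * q.1 j := sum_mul_pos (simplexInv_pos p) q
  have hS := sum_inv_pos p
  have hmul : ∀ i, p.1 i * portfolioMap φ (simplexInv p.1) i =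
      -- Multiplication by p undoes p⁻¹ up to a factor independent of i, which the normalization in
      -- ⊙ removes.
      ((∑ j, 1 / p.1 j) * ∑ j, simplexInv p.1 j * q.1 j)⁻¹ * q.1 i := by
    intro i
    rw [portfolioMap_eq (simplexInv_mem hn p) hφ q h i]
    have hi : p.1 i * simplexInv p.1 i = (∑ j, 1 / p.1 j)⁻¹ := by
      rw [simplexInv, ← mul_div_assoc, mul_one_div_cancel (p.pos i).ne', one_div]
    rw [mul_inv, ← hi]
    ring
  funext i
  simp only [odot, hmul]
  rw [← Finset.mul_sum, q.2.2, mul_one, mul_div_assoc, mul_div_cancel₀]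
  exact inv_ne_zero (mul_pos hS hD).ne'

/-! ### The cost modulo separable terms -/

/-- The logarithmic pairing `log ⟨p⁻¹, q⟩`, the part of the cost that is not separable. -/
noncomputable def logPairing (p q : Simplex n) : ℝ := Real.log (∑ i, simplexInv p.1 i * q.1 i)

lemma cost_eq (p q : Simplex n) :
    cost p q = logPairing p q + (Real.log (1 / n) + Real.log (∑ j, 1 / p.1 j) +
      (1 / n) * ∑ i, Real.log (p.1 i)) + -((1 / n) * ∑ i, Real.log (q.1 i)) := by
  have := p.neZero
  have hn : (0 : ℝ) < 1 / n := one_div_pos.2 (by exact_mod_cast Nat.pos_of_ne_zero (NeZero.ne n))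
  have hS := sum_inv_pos p
  have h1 : ∑ i, q.1 i / p.1 i = (∑ j, 1 / p.1 j) * ∑ i, simplexInv p.1 i * q.1 i := by
    rw [Finset.mul_sum]
    refine Finset.sum_congr rfl fun i _ => ?_
    rw [simplexInv, ← mul_assoc, mul_div_cancel₀ _ hS.ne']
    ring
  have hD := sum_mul_pos (simplexInv_pos p) q
  rw [cost, h1, Real.log_mul hn.ne' (mul_pos hS hD).ne', Real.log_mul hS.ne' hD.ne', logPairing]
  simp only [Real.log_div (q.pos _).ne' (p.pos _).ne', Finset.sum_sub_distrib]
  ring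

lemma cost_nonneg (p q : Simplex n) : 0 ≤ cost p q := by
  have := p.neZero
  have hn : (0 : ℝ) < n := by exact_mod_cast Nat.pos_of_ne_zero (NeZero.ne n)
  have h := strictConcaveOn_log_Ioi.concaveOn.le_map_sum (t := Finset.univ)
    (w := fun _ : Fin n => 1 / (n : ℝ)) (p := fun i => q.1 i / p.1 i) (fun _ _ => by positivity)
    (by simp [hn.ne']) (fun i _ => div_pos (q.pos i) (p.pos i))
  simp only [smul_eq_mul, ← Finset.mul_sum] at h
  rw [cost]
  linarith

lemma continuous_cost : Continuous fun z : Simplex n × Simplex n => cost z.1 z.2 := by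
  have h1 : ∀ i, Continuous fun z : Simplex n × Simplex n => z.1.1 i := fun i =>
    (continuous_apply i).comp (continuous_subtype_val.comp continuous_fst)
  have h2 : ∀ i, Continuous fun z : Simplex n × Simplex n => z.2.1 i := fun i =>
    (continuous_apply i).comp (continuous_subtype_val.comp continuous_snd)
  have h3 : ∀ i, Continuous fun z : Simplex n × Simplex n => z.2.1 i / z.1.1 i :=
    fun i => (h2 i).div (h1 i) fun z => (z.1.pos i).ne'
  unfold cost
  refine Continuous.sub (Continuous.log (by fun_prop) fun z => ?_) ?_
  · have := z.1.neZero
    have hn : (0 : ℝ) < n := by exact_mod_cast Nat.pos_of_ne_zero (NeZero.ne n)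
    exact (mul_pos (one_div_pos.2 hn) (Finset.sum_pos
      (fun i _ => div_pos (z.2.pos i) (z.1.pos i)) Finset.univ_nonempty)).ne'
  · exact continuous_const.mul (continuous_finsetSum _ fun i _ =>
      (h3 i).log fun z => (div_pos (z.2.pos i) (z.1.pos i)).ne')

/-- Log-moments control the cost: q_i / p_i ≤ q_i exp(∑ |log p_j|) bounds the first term, and log
p_i ≤ 0 bounds the second. -/
lemma cost_le (p q : Simplex n) :
    cost p q ≤ ∑ i, |Real.log (p.1 i)| + ∑ i, |Real.log (q.1 i)| := by
  have := p.neZero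
  have hn : (1 : ℝ) ≤ n := by exact_mod_cast Nat.one_le_iff_ne_zero.2 (NeZero.ne n)
  have hinv : 1 / (n : ℝ) ≤ 1 := by rw [div_le_one (by linarith)]; exact hn
  have hlp : ∀ i, Real.log (p.1 i) ≤ 0 := fun i => Real.log_nonpos (p.pos i).le (p.le_one i)
  have hlq : ∀ i, Real.log (q.1 i) ≤ 0 := fun i => Real.log_nonpos (q.pos i).le (q.le_one i)
  have h1 : Real.log ((1 / (n : ℝ)) * ∑ i, q.1 i / p.1 i) ≤ ∑ i, |Real.log (p.1 i)| := by
    have hs : 0 < ∑ i, q.1 i / p.1 i :=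
      Finset.sum_pos (fun i _ => div_pos (q.pos i) (p.pos i)) Finset.univ_nonempty
    rw [Real.log_le_iff_le_exp (by positivity)]
    calc (1 / (n : ℝ)) * ∑ i, q.1 i / p.1 i ≤ ∑ i, q.1 i / p.1 i :=
          mul_le_of_le_one_left hs.le hinv
      _ ≤ ∑ i, q.1 i * Real.exp (∑ i, |Real.log (p.1 i)|) := by
          refine Finset.sum_le_sum fun i _ => ?_
          rw [div_eq_mul_inv]
          refine mul_le_mul_of_nonneg_left ?_ (q.pos i).le
          rw [← Real.exp_log (inv_pos.2 (p.pos i)), Real.exp_le_exp, Real.log_inv]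
          exact (neg_le_abs _).trans (Finset.single_le_sum (f := fun i => |Real.log (p.1 i)|)
            (fun j _ => abs_nonneg _) (Finset.mem_univ i))
      _ = _ := by rw [← Finset.sum_mul, q.2.2, one_mul]
  have h2 : -((1 / (n : ℝ)) * ∑ i, Real.log (q.1 i / p.1 i)) ≤ ∑ i, |Real.log (q.1 i)| := by
    rw [← mul_neg, ← Finset.sum_neg_distrib]
    have h3 : ∑ i, -Real.log (q.1 i / p.1 i) ≤ ∑ i, |Real.log (q.1 i)| := by
      refine Finset.sum_le_sum fun i _ => ?_
      rw [Real.log_div (q.pos i).ne' (p.pos i).ne', abs_of_nonpos (hlq i)]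
      linarith [hlp i]
    have h4 : 0 ≤ ∑ i, |Real.log (q.1 i)| := Finset.sum_nonneg fun i _ => abs_nonneg _
    exact (mul_le_mul_of_nonneg_left h3 (by positivity)).trans (mul_le_of_le_one_left h4 hinv)
  rw [cost]
  linarith

lemma couplingCost_ne_top {P Q : Measure (Simplex n)} (hP : ClassL P) (hQ : ClassL Q)
    {R : Measure (Simplex n × Simplex n)} (hR : IsCoupling P Q R) : couplingCost R ≠ ∞ := by
  have hmeas : ∀ i, Measurable fun p : Simplex n => ENNReal.ofReal |Real.log (p.1 i)| := fun i => by
    have : Measurable fun p : Simplex n => p.1 i := (measurable_pi_apply i).comp measurable_subtype_coe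
    exact (this.log.abs).ennreal_ofReal
  have hbound : ∀ z : Simplex n × Simplex n, ENNReal.ofReal (cost z.1 z.2) ≤
      ∑ i, ENNReal.ofReal |Real.log (z.1.1 i)| + ∑ i, ENNReal.ofReal |Real.log (z.2.1 i)| := by
    intro z
    rw [← ENNReal.ofReal_sum_of_nonneg fun i _ => abs_nonneg _,
      ← ENNReal.ofReal_sum_of_nonneg fun i _ => abs_nonneg _,
      ← ENNReal.ofReal_add (Finset.sum_nonneg fun i _ => abs_nonneg _)
        (Finset.sum_nonneg fun i _ => abs_nonneg _)]
    exact ENNReal.ofReal_le_ofReal (cost_le _ _)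
  have hfst : ∀ i, Measurable fun z : Simplex n × Simplex n =>
      ENNReal.ofReal |Real.log (z.1.1 i)| := fun i => (hmeas i).comp measurable_fst
  have hsnd : ∀ i, Measurable fun z : Simplex n × Simplex n =>
      ENNReal.ofReal |Real.log (z.2.1 i)| := fun i => (hmeas i).comp measurable_snd
  have hint : ∀ i, ∫⁻ z : Simplex n × Simplex n, ENNReal.ofReal |Real.log (z.1.1 i)| ∂ R =
      ∫⁻ p, ENNReal.ofReal |Real.log (p.1 i)| ∂ P := fun i => by
    rw [← hR.1, lintegral_map (hmeas i) measurable_fst]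
  have hint' : ∀ i, ∫⁻ z : Simplex n × Simplex n, ENNReal.ofReal |Real.log (z.2.1 i)| ∂ R =
      ∫⁻ p, ENNReal.ofReal |Real.log (p.1 i)| ∂ Q := fun i => by
    rw [← hR.2, lintegral_map (hmeas i) measurable_snd]
  refine ((lintegral_mono hbound).trans_lt ?_).ne
  rw [lintegral_add_left (Finset.measurable_fun_sum Finset.univ fun i _ => hfst i),
    lintegral_finsetSum _ fun i _ => hfst i,
    lintegral_finsetSum _ fun i _ => hsnd i]
  simp only [hint, hint']
  exact ENNReal.add_lt_top.2 ⟨hP, hQ⟩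

/-! ### Cyclically monotone sets and their chain potentials -/

/-- Cyclical monotonicity for the logarithmic pairing. -/
def IsCyclicallyMonotone (Γ : Set (Simplex n × Simplex n)) : Prop :=
  ∀ (m : ℕ) (z : ℕ → Simplex n × Simplex n), (∀ k, z k ∈ Γ) →
    ∑ k ∈ Finset.range (m + 1), logPairing (z k).1 (z k).2 ≤
      ∑ k ∈ Finset.range m, logPairing (z (k + 1)).1 (z k).2 + logPairing (z 0).1 (z m).2

lemma IsCoupling.isProbabilityMeasure {P Q : Measure (Simplex n)} [IsProbabilityMeasure P]
    {R : Measure (Simplex n × Simplex n)} (hR : IsCoupling P Q R) : IsProbabilityMeasure R := by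
  constructor
  rw [← Set.preimage_univ (f := Prod.fst), ← Measure.map_apply measurable_fst MeasurableSet.univ,
    hR.1, measure_univ]

lemma isCyclicallyMonotone_support {P Q : Measure (Simplex n)} [IsProbabilityMeasure P]
    (hP : ClassL P) (hQ : ClassL Q) {R : Measure (Simplex n × Simplex n)}
    (hR : IsOptimalCoupling P Q R) : IsCyclicallyMonotone R.support := by
  intro m z hz
  have := hR.1.isProbabilityMeasure
  have h := sum_le_sum_of_mem_support_of_optimal (R := R) continuous_cost
    (fun z => cost_nonneg z.1 z.2) (couplingCost_ne_top hP hQ hR.1)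
    (fun ρ h1 h2 => hR.2.le.trans (iInf₂_le ρ ⟨h1.trans hR.1.1, h2.trans hR.1.2⟩))
    -- The inverse rotation pairs p_i with the preceding q. After reindexing, p_{k+1} meets q_k, and
    -- p_0 meets q_m closes the cycle.
    (x := fun i : Fin (m + 1) => z i) (fun i => hz i) (finRotate (m + 1)).symm
  simp only [cost_eq, Finset.sum_add_distrib (s := Finset.univ)] at h
  rw [Equiv.sum_comp (finRotate (m + 1)).symm
    (fun i : Fin (m + 1) => -((1 / n : ℝ) * ∑ j, Real.log ((z i).2.1 j)))] at h
  have h' : ∑ i : Fin (m + 1), logPairing (z i).1 (z i).2 ≤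
      ∑ i : Fin (m + 1), logPairing (z i).1 (z ((finRotate (m + 1)).symm i)).2 := by
    linarith
  rw [← Equiv.sum_comp (finRotate (m + 1)) fun i : Fin (m + 1) =>
    logPairing (z i).1 (z ((finRotate (m + 1)).symm i)).2] at h'
  simp only [Equiv.symm_apply_apply] at h'
  rw [Fin.sum_univ_castSucc (n := m)
    (f := fun i => logPairing (z (finRotate (m + 1) i)).1 (z i).2)] at h'
  simp only [finRotate_apply, Fin.coeSucc_eq_succ] at h'
  rw [Finset.sum_range, Finset.sum_range]
  simpa using h'

/-- The pairs `(k, q)` for which `r ↦ k + log ⟨r, q⟩` is the function of a chain in `Γ` from `z₀`. -/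
def chainSet (Γ : Set (Simplex n × Simplex n)) (z₀ : Simplex n × Simplex n) :
    Set (ℝ × Simplex n) :=
  {s | ∃ (m : ℕ) (z : ℕ → Simplex n × Simplex n), z 0 = z₀ ∧ (∀ k, z k ∈ Γ) ∧
    s = (∑ k ∈ Finset.range m, logPairing (z (k + 1)).1 (z k).2 -
      ∑ k ∈ Finset.range (m + 1), logPairing (z k).1 (z k).2, (z m).2)}

lemma chainSet_nonempty {Γ : Set (Simplex n × Simplex n)} {z₀ : Simplex n × Simplex n}
    (h₀ : z₀ ∈ Γ) : (chainSet Γ z₀).Nonempty :=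
  ⟨_, 0, fun _ => z₀, rfl, fun _ => h₀, rfl⟩

/-- At the inverse of the first component of `z₀`, nonnegativity of every chain function is exactly
cyclical monotonicity of the closed chain. -/
lemma IsCyclicallyMonotone.isLowerBounded {Γ : Set (Simplex n × Simplex n)}
    (hΓ : IsCyclicallyMonotone Γ) (z₀ : Simplex n × Simplex n) :
    IsLowerBounded (chainSet Γ z₀) := by
  refine ⟨simplexInv z₀.1.1, simplexInv_pos _, 0, ?_⟩
  rintro _ ⟨m, z, rfl, hz, rfl⟩
  have := hΓ m z hz
  rw [logPairing] at this
  simp only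
  linarith

lemma mem_chainSet_of_mem {Γ : Set (Simplex n × Simplex n)} {z₀ : Simplex n × Simplex n}
    {s : ℝ × Simplex n} (hs : s ∈ chainSet Γ z₀) {w : Simplex n × Simplex n} (hw : w ∈ Γ) :
    (s.1 + logPairing w.1 s.2 - logPairing w.1 w.2, w.2) ∈ chainSet Γ z₀ := by
  obtain ⟨m, z, h0, hz, rfl⟩ := hs
  let y : ℕ → Simplex n × Simplex n := fun k => if k ≤ m then z k else w
  have hy : ∀ k ≤ m, y k = z k := fun k hk => if_pos hk
  have hyw : y (m + 1) = w := if_neg (by omega)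
  refine ⟨m + 1, y, by rw [hy 0 (Nat.zero_le m), h0], fun k => ?_, ?_⟩
  · simp only [y]
    split_ifs
    exacts [hz k, hw]
  · rw [Finset.sum_range_succ (fun k => logPairing (y k).1 (y k).2) (m + 1),
      Finset.sum_range_succ (fun k => logPairing (y (k + 1)).1 (y k).2) m, hyw, hy m le_rfl]
    have e1 : ∑ k ∈ Finset.range m, logPairing (y (k + 1)).1 (y k).2 =
        ∑ k ∈ Finset.range m, logPairing (z (k + 1)).1 (z k).2 :=
      Finset.sum_congr rfl fun k hk => by
        have := Finset.mem_range.1 hk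
        rw [hy k (by omega), hy (k + 1) (by omega)]
    have e2 : ∑ k ∈ Finset.range (m + 1), logPairing (y k).1 (y k).2 =
        ∑ k ∈ Finset.range (m + 1), logPairing (z k).1 (z k).2 :=
      Finset.sum_congr rfl fun k hk => by
        have := Finset.mem_range.1 hk
        rw [hy k (by omega)]
    rw [e1, e2]
    simp only [Prod.mk.injEq, and_true]
    ring

/-- A cyclically monotone set lies in the superdifferential of its chain potential. -/
lemma IsCyclicallyMonotone.logPotential_le_of_mem {Γ : Set (Simplex n × Simplex n)}
    (hΓ : IsCyclicallyMonotone Γ) {z₀ w : Simplex n × Simplex n} (h₀ : z₀ ∈ Γ) (hw : w ∈ Γ)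
    {s : Fin n → ℝ} (hs : s ∈ openSimplex n) :
    logPotential (chainSet Γ z₀) s ≤ logPotential (chainSet Γ z₀) (simplexInv w.1.1) +
      Real.log (∑ i, s i * w.2.1 i) - Real.log (∑ i, simplexInv w.1.1 i * w.2.1 i) := by
  suffices h : logPotential (chainSet Γ z₀) s - Real.log (∑ i, s i * w.2.1 i) +
      logPairing w.1 w.2 ≤ logPotential (chainSet Γ z₀) (simplexInv w.1.1) by
    rw [logPairing] at h
    linarith
  -- Appending `w` to the chain of `t` gives a chain function ending at `w.2`, and φ(s) is at most
  -- its value at s. The infimum over `t` recovers φ at the inverse of `w.1`.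
  refine le_logPotential (chainSet_nonempty h₀) fun t ht => ?_
  have h := logPotential_le (hΓ.isLowerBounded z₀) (fun i => (hs.1 i).1) (mem_chainSet_of_mem ht hw)
  rw [logPairing] at h
  simp only at h
  linarith

/-! ### Optimal couplings are graphs; uniqueness -/

/-- Every optimal coupling is carried by the graph given by the portfolio map of an exponentially
concave function. -/
theorem exists_expConcave_of_isOptimalCoupling (hn : 2 ≤ n) {P Q : Measure (Simplex n)}
    [IsProbabilityMeasure P] (hP : ClassLa P) (hQ : ClassL Q)
    {R : Measure (Simplex n × Simplex n)} (hR : IsOptimalCoupling P Q R) :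
    ∃ φ : (Fin n → ℝ) → ℝ, ExpConcave φ ∧
      (∀ᵐ p ∂P, DifferentiableAtSimplex φ (simplexInv p.1)) ∧
      ∀ᵐ z ∂ R, z.2.1 = odot z.1.1 (portfolioMap φ (simplexInv z.1.1)) := by
  have := hR.1.isProbabilityMeasure
  have hΓ := isCyclicallyMonotone_support hP.1 hQ hR
  obtain ⟨z₀, h₀⟩ := Measure.nonempty_support (IsProbabilityMeasure.ne_zero R)
  have hne := chainSet_nonempty h₀
  have hbd := hΓ.isLowerBounded z₀
  have hdiff : ∀ᵐ p ∂P, DifferentiableAt ℝ (logPotential (chainSet R.support z₀))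
      (simplexInv p.1) := hP.2.ae_le (ae_differentiableAt_logPotential hne hbd)
  refine ⟨logPotential (chainSet R.support z₀), expConcave_logPotential hne hbd,
    hdiff.mono fun p hp => hp.differentiableWithinAt, ?_⟩
  rw [← hR.1.1] at hdiff
  filter_upwards [ae_of_ae_map measurable_fst.aemeasurable hdiff, Measure.support_mem_ae]
    with z hz hzΓ
  exact (odot_portfolioMap_eq hn z.1 z.2 hz fun s hs =>
    hΓ.logPotential_le_of_mem h₀ hzΓ hs).symm

/-- A coupling carried by the graph of a function is carried by the graph of a measurable one. -/
lemma exists_measurable_of_ae_eq {R : Measure (Simplex n × Simplex n)} [IsProbabilityMeasure R]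
    {G : Simplex n → Fin n → ℝ} (hG : ∀ᵐ z ∂ R, z.2.1 = G z.1) :
    ∃ T : Simplex n → Simplex n, Measurable T ∧ (∀ᵐ p ∂(R.map Prod.fst), (T p).1 = G p) ∧
      ∀ᵐ z ∂ R, z.2 = T z.1 := by
  classical
  obtain ⟨z₀⟩ : Nonempty (Simplex n × Simplex n) := nonempty_of_isProbabilityMeasure R
  have : Nonempty (Simplex n) := ⟨z₀.2⟩
  -- No measurability of `G` is assumed. For almost every p the conditional law is a point mass at
  -- `G p`, so its mean, which is measurable in p, is a version of `G`.
  let g : Simplex n → Fin n → ℝ := fun p i => ∫ q : Simplex n, q.1 i ∂(R.condKernel p)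
  have hg : Measurable g := by
    refine measurable_pi_lambda _ fun i => ?_
    have h1 : StronglyMeasurable fun z : Simplex n × Simplex n => z.2.1 i :=
      ((measurable_pi_apply i).comp (measurable_subtype_coe.comp measurable_snd)).stronglyMeasurable
    exact (h1.integral_kernel_prod_right' (κ := R.condKernel)).measurable
  let T : Simplex n → Simplex n := fun p =>
    -- The fallback `z₀.2` is used only on a null set.
    if h : g p ∈ openSimplex n then ⟨g p, h⟩ else z₀.2
  have hT : Measurable T := by
    refine Measurable.dite (s := g ⁻¹' openSimplex n) (f := fun p => ⟨g p.1, p.2⟩)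
      (g := fun _ => z₀.2) ?_ ?_ (hg (measurableSet_openSimplex n))
    · exact (hg.comp measurable_subtype_coe).subtype_mk
    · exact measurable_const
  have hTG : ∀ᵐ p ∂(R.map Prod.fst), (T p).1 = G p := by
    have hdis : R.fst ⊗ₘ R.condKernel = R := R.disintegrate R.condKernel
    rw [← hdis] at hG
    filter_upwards [Measure.ae_ae_of_ae_compProd hG] with p hp
    obtain ⟨q, hq⟩ := hp.exists
    have hgp : g p = G p := by
      funext i
      have h1 : ∫ q : Simplex n, q.1 i ∂(R.condKernel p) = ∫ _, G p i ∂(R.condKernel p) :=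
        integral_congr_ae (hp.mono fun q hq => congrFun hq i)
      simpa using h1
    have hmem : g p ∈ openSimplex n := by rw [hgp, ← hq]; exact q.2
    simp only [T, dif_pos hmem, hgp]
  refine ⟨T, hT, hTG, ?_⟩
  filter_upwards [hG, ae_of_ae_map measurable_fst.aemeasurable hTG] with z h1 h2
  exact Subtype.ext (h1.trans h2.symm)

lemma eq_map_of_ae_eq {R : Measure (Simplex n × Simplex n)} {T : Simplex n → Simplex n}
    (hT : Measurable T) (h : ∀ᵐ z ∂ R, z.2 = T z.1) :
    R = (R.map Prod.fst).map fun p => (p, T p) := by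
  rw [Measure.map_map (by fun_prop) measurable_fst]
  conv_lhs => rw [← Measure.map_id (μ := R)]
  refine Measure.map_congr ?_
  filter_upwards [h] with z hz
  exact Prod.ext rfl hz

lemma exists_isOptimalCoupling (P Q : Measure (Simplex n)) [IsProbabilityMeasure P]
    [IsProbabilityMeasure Q] : ∃ R, IsOptimalCoupling P Q R := by
  obtain ⟨R, hR, hopt⟩ := exists_optimal_coupling P Q (continuous_cost (n := n))
  exact ⟨R, hR, le_antisymm (le_iInf₂ fun ρ hρ => hopt ρ hρ.1 hρ.2) (iInf₂_le R hR)⟩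

/-- The midpoint of two optimal couplings is optimal. -/
lemma IsOptimalCoupling.midpoint {P Q : Measure (Simplex n)} {R₁ R₂ : Measure (Simplex n × Simplex n)}
    (h₁ : IsOptimalCoupling P Q R₁) (h₂ : IsOptimalCoupling P Q R₂) :
    IsOptimalCoupling P Q ((2⁻¹ : ℝ≥0∞) • (R₁ + R₂)) := by
  refine ⟨⟨?_, ?_⟩, ?_⟩
  · rw [Measure.map_smul, Measure.map_add _ _ measurable_fst, h₁.1.1, h₂.1.1, smul_add, ← add_smul,
      ENNReal.inv_two_add_inv_two, one_smul]
  · rw [Measure.map_smul, Measure.map_add _ _ measurable_snd, h₁.1.2, h₂.1.2, smul_add, ← add_smul,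
      ENNReal.inv_two_add_inv_two, one_smul]
  · rw [couplingCost, lintegral_smul_measure, lintegral_add_measure, ← couplingCost, ← couplingCost,
      h₁.2, h₂.2, smul_add, ← add_smul, ENNReal.inv_two_add_inv_two, one_smul]

theorem IsOptimalCoupling.unique (hn : 2 ≤ n) {P Q : Measure (Simplex n)}
    [IsProbabilityMeasure P] (hP : ClassLa P) (hQ : ClassL Q)
    {R₁ R₂ : Measure (Simplex n × Simplex n)} (h₁ : IsOptimalCoupling P Q R₁)
    (h₂ : IsOptimalCoupling P Q R₂) : R₁ = R₂ := by
  have hmid := h₁.midpoint h₂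
  have := hmid.1.isProbabilityMeasure
  obtain ⟨φ, -, -, hφ⟩ := exists_expConcave_of_isOptimalCoupling hn hP hQ hmid
  obtain ⟨T, hT, -, hTR⟩ := exists_measurable_of_ae_eq
    (G := fun p => odot p.1 (portfolioMap φ (simplexInv p.1))) hφ
  -- A property holding almost everywhere for the midpoint holds almost everywhere for both
  -- couplings, so they share the map `T` and the first marginal `P`.
  rw [Measure.ae_ennreal_smul_measure_iff (by simp), ae_add_measure_iff] at hTR
  rw [eq_map_of_ae_eq hT hTR.1, eq_map_of_ae_eq hT hTR.2, h₁.1.1, h₂.1.1]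


end SimplexTransport

/-- `T` is a Borel version of the `P`-a.e. defined map `p ↦ p ⊙ π(p⁻¹)`. -/
theorem theorem4 (n : ℕ) (hn : 2 ≤ n)
    (P Q : MeasureTheory.Measure (SimplexTransport.Simplex n))
    [MeasureTheory.IsProbabilityMeasure P] [MeasureTheory.IsProbabilityMeasure Q]
    (hP : SimplexTransport.ClassLa P) (hQ : SimplexTransport.ClassL Q) :
    ∃ φ : (Fin n → ℝ) → ℝ, SimplexTransport.ExpConcave φ ∧
      ∃ T : SimplexTransport.Simplex n → SimplexTransport.Simplex n, Measurable T ∧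
        (∀ᵐ p ∂P,
          SimplexTransport.DifferentiableAtSimplex φ (SimplexTransport.simplexInv p.1) ∧
          (T p).1 = SimplexTransport.odot p.1
            (SimplexTransport.portfolioMap φ (SimplexTransport.simplexInv p.1))) ∧
        P.map T = Q ∧
        SimplexTransport.IsOptimalCoupling P Q (P.map fun p => (p, T p)) ∧
        (∀ R : MeasureTheory.Measure (SimplexTransport.Simplex n × SimplexTransport.Simplex n),
          SimplexTransport.IsOptimalCoupling P Q R → R = P.map fun p => (p, T p)) ∧
        (∀ S : SimplexTransport.Simplex n → SimplexTransport.Simplex n, AEMeasurable S P →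
          P.map S = Q →
          SimplexTransport.IsOptimalCoupling P Q (P.map fun p => (p, S p)) →
          ∀ᵐ p ∂P, S p = T p) := by
  obtain ⟨R, hR⟩ := SimplexTransport.exists_isOptimalCoupling P Q
  have := hR.1.isProbabilityMeasure
  obtain ⟨φ, hφ, hdiff, hgraph⟩ :=
    SimplexTransport.exists_expConcave_of_isOptimalCoupling hn hP hQ hR
  obtain ⟨T, hT, hTG, hTR⟩ := SimplexTransport.exists_measurable_of_ae_eq
    (G := fun p => SimplexTransport.odot p.1
      (SimplexTransport.portfolioMap φ (SimplexTransport.simplexInv p.1))) hgraph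
  have hRT := SimplexTransport.eq_map_of_ae_eq hT hTR
  rw [hR.1.1] at hRT hTG
  have hPT : Measurable fun p => (p, T p) := measurable_id.prodMk hT
  refine ⟨φ, hφ, T, hT, hdiff.and hTG, ?_, hRT ▸ hR, fun R' hR' => ?_, fun S hS _ hSopt => ?_⟩
  · rw [← hR.1.2, hRT, MeasureTheory.Measure.map_map measurable_snd hPT]
    rfl
  · rw [hR'.unique hn hP hQ hR, ← hRT]
  · have hST := hSopt.unique hn hP hQ hR
    rw [← hST] at hTR
    exact MeasureTheory.ae_of_ae_map (aemeasurable_id.prodMk hS) hTR
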